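/- Theorem. Let $\mathcal{H}$ be a complex Hilbert space and let $\mathcal{A},\mathcal{B}\subset\mathcal{B}(\mathcal{H})$ be a simple bipartite system, i.e. $\mathcal{A}$ and $\mathcal{B}$ are hyperfinite and $\sigma$-finite von Neumann factors on $\mathcal{H}$ which commute elementwise, satisfy $\mathcal{A}\cap\mathcal{B}=\mathbb{C}1$, and generate $\mathcal{B}(\mathcal{H})$, i.e. $(\mathcal{A}\cup\mathcal{B})''=\mathcal{B}(\mathcal{H})$. (Hyperfinite means generated as a von Neumann algebra by an increasing sequence of finite-dimensional $*$-subalgebras.) Suppose that the split property holds: there is a type I factor $\mathcal{N}$ with $\mathcal{A}\subset\mathcal{N}\subset\mathcal{B}'$. Then no normal state $\omega$ on $\mathcal{B}(\mathcal{H})$ has infinite one-copy entanglement with respect to $\mathcal{A},\mathcal{B}$. Here $\omega$ has infinite one-copy entanglement if for every integer $d\ge 2$ and every $\epsilon>0$ there is a local operation $T:\mathcal{B}(\mathbb{C}^d)\otimes\mathcal{B}(\mathbb{C}^d)\to\mathcal{B}(\mathcal{H})$ with $\omega\bigl(T(|\chi_d\rangle\langle\chi_d|)\bigr)>1-\epsilon$,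 where $\chi_d=\frac{1}{\sqrt d}\sum_{j=1}^d|jj\rangle$. A local operation is a unital completely positive map $T$ such that $T(a\otimes 1)\in\mathcal{A}$, $T(1\otimes b)\in\mathcal{B}$ and $T(a\otimes b)=T(a\otimes 1)\,T(1\otimes b)$ for all $a,b\in\mathcal{B}(\mathbb{C}^d)$. -/

import Mathlib

open scoped ComplexOrder CStarAlgebra Kronecker InnerProductSpace

noncomputable section

universe u v

/-! ### Bipartite systems and local operations -/

/-- A pair of unital C*-subalgebras `A`, `B` of a common ambient unital C*-algebra `M` which commute
elementwise and satisfy `A ∩ B = ℂ 1`. -/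
structure IsBipartiteSystem {M : Type u} [CStarAlgebra M] (A B : StarSubalgebra ℂ M) : Prop where
  isClosed_left : IsClosed (A : Set M)
  isClosed_right : IsClosed (B : Set M)
  commute : ∀ a ∈ A, ∀ b ∈ B, a * b = b * a
  inter_eq : ∀ x : M, (x ∈ A ∧ x ∈ B) ↔ ∃ c : ℂ, x = c • (1 : M)

/-- A completely positive map `T : M₁ → M₂` is a local operation from the bipartite system
`A₁, B₁ ⊆ M₁` to the bipartite system `A₂, B₂ ⊆ M₂` if it is unital, maps `A₁` into `A₂` and `B₁`
into `B₂`, and satisfies `T (a b) = T a T b` for all `a ∈ A₁`, `b ∈ B₁`. -/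
structure IsLocalOperation {M₁ : Type u} {M₂ : Type v}
    [CStarAlgebra M₁] [PartialOrder M₁] [StarOrderedRing M₁]
    [CStarAlgebra M₂] [PartialOrder M₂] [StarOrderedRing M₂]
    (A₁ B₁ : StarSubalgebra ℂ M₁) (A₂ B₂ : StarSubalgebra ℂ M₂) (T : M₁ →CP M₂) : Prop where
  map_one : T 1 = 1
  map_left : ∀ a ∈ A₁, T a ∈ A₂
  map_right : ∀ b ∈ B₁, T b ∈ B₂
  map_mul : ∀ a ∈ A₁, ∀ b ∈ B₁, T (a * b) = T a * T b

/-! ### The pair of two `d`-level systems -/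

/-- The Hilbert space `ℂ^d ⊗ ℂ^d`, in the coordinates given by the product basis `|jk⟩`. -/
abbrev TwoQudit (d : ℕ) : Type := EuclideanSpace ℂ (Fin d × Fin d)

/-- The embedding `a ↦ a ⊗ 1` of the `d × d` matrices into the operators on `ℂ^d ⊗ ℂ^d`. -/
def leftEmbed (d : ℕ) : Matrix (Fin d) (Fin d) ℂ →⋆ₐ[ℂ] (TwoQudit d →L[ℂ] TwoQudit d) :=
  (Matrix.toEuclideanCLM (n := Fin d × Fin d) (𝕜 := ℂ) : _ →⋆ₐ[ℂ] _).comp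
    { toFun := fun a => a ⊗ₖ (1 : Matrix (Fin d) (Fin d) ℂ)
      map_one' := Matrix.one_kronecker_one
      map_mul' := fun a b => by rw [← Matrix.mul_kronecker_mul, one_mul]
      map_zero' := Matrix.zero_kronecker _
      map_add' := fun a b => Matrix.add_kronecker a b _
      commutes' := fun c => by
        simp only [Algebra.algebraMap_eq_smul_one, Matrix.smul_kronecker, Matrix.one_kronecker_one]
      map_star' := fun a => by
        simp only [Matrix.star_eq_conjTranspose, Matrix.conjTranspose_kronecker,
          Matrix.conjTranspose_one] }

/-- The embedding `b ↦ 1 ⊗ b` of the `d × d` matrices into the operators on `ℂ^d ⊗ ℂ^d`. -/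
def rightEmbed (d : ℕ) : Matrix (Fin d) (Fin d) ℂ →⋆ₐ[ℂ] (TwoQudit d →L[ℂ] TwoQudit d) :=
  (Matrix.toEuclideanCLM (n := Fin d × Fin d) (𝕜 := ℂ) : _ →⋆ₐ[ℂ] _).comp
    { toFun := fun b => (1 : Matrix (Fin d) (Fin d) ℂ) ⊗ₖ b
      map_one' := Matrix.one_kronecker_one
      map_mul' := fun a b => by rw [← Matrix.mul_kronecker_mul, one_mul]
      map_zero' := Matrix.kronecker_zero _
      map_add' := fun a b => Matrix.kronecker_add _ a b
      commutes' := fun c => by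
        simp only [Algebra.algebraMap_eq_smul_one, Matrix.kronecker_smul, Matrix.one_kronecker_one]
      map_star' := fun a => by
        simp only [Matrix.star_eq_conjTranspose, Matrix.conjTranspose_kronecker,
          Matrix.conjTranspose_one] }

/-- The algebra `B(ℂ^d) ⊗ 1`. -/
def leftAlgebra (d : ℕ) : StarSubalgebra ℂ (TwoQudit d →L[ℂ] TwoQudit d) := (leftEmbed d).range

/-- The algebra `1 ⊗ B(ℂ^d)`. -/
def rightAlgebra (d : ℕ) : StarSubalgebra ℂ (TwoQudit d →L[ℂ] TwoQudit d) := (rightEmbed d).range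

/-- The maximally entangled vector `χ_d = d^{-1/2} ∑_j |jj⟩`. -/
def maxEntangledVector (d : ℕ) : TwoQudit d :=
  ((1 / Real.sqrt d : ℝ) : ℂ) • ∑ j : Fin d, EuclideanSpace.single (j, j) (1 : ℂ)

/-- The operator `|χ_d⟩⟨χ_d|`. -/
def maxEntangledProj (d : ℕ) : TwoQudit d →L[ℂ] TwoQudit d :=
  InnerProductSpace.rankOne ℂ (maxEntangledVector d) (maxEntangledVector d)

/-! ### States and one-copy entanglement -/

/-- A state of a unital C*-algebra: a positive linear functional `ω` with `ω 1 = 1`. -/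
def IsState {M : Type u} [CStarAlgebra M] [PartialOrder M] [StarOrderedRing M]
    (ω : M →ₚ[ℂ] ℂ) : Prop :=
  ω 1 = 1

/-- A functional has infinite one-copy entanglement with respect to `A, B ⊆ M` if for every `d ≥ 2`
and every `ε > 0` there is a local operation `T : B(ℂ^d) ⊗ B(ℂ^d) → M` with
`ω (T |χ_d⟩⟨χ_d|) > 1 - ε`. -/
def HasInfiniteOneCopyEntanglement {M : Type u} [CStarAlgebra M] [PartialOrder M]
    [StarOrderedRing M] (A B : StarSubalgebra ℂ M) (ω : M →ₚ[ℂ] ℂ) : Prop :=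
  ∀ d : ℕ, 2 ≤ d → ∀ ε : ℝ, 0 < ε →
    ∃ T : (TwoQudit d →L[ℂ] TwoQudit d) →CP M,
      IsLocalOperation (leftAlgebra d) (rightAlgebra d) A B T ∧
        1 - ε < (ω (T (maxEntangledProj d))).re

/-! ### Von Neumann algebras on a Hilbert space -/

section VonNeumann

variable {H : Type u} [NormedAddCommGroup H] [InnerProductSpace ℂ H] [CompleteSpace H]

/-- A positive functional on `B(H)` is normal if it preserves suprema of directed families of
self-adjoint operators (the suprema are taken in the usual operator order). -/
def IsNormalFunctional (ω : (H →L[ℂ] H) →ₚ[ℂ] ℂ) : Prop :=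
  ∀ (D : Set (H →L[ℂ] H)) (s : H →L[ℂ] H), D.Nonempty → DirectedOn (· ≤ ·) D →
    (∀ x ∈ D, IsSelfAdjoint x) → IsLUB D s →
      IsLUB ((fun x => (ω x).re) '' D) (ω s).re

/-- A factor: the center consists of the multiples of the identity. -/
def IsFactor (N : VonNeumannAlgebra H) : Prop :=
  ∀ x ∈ N, x ∈ N.commutant → ∃ c : ℂ, x = c • (1 : H →L[ℂ] H)

/-- A type I factor: a factor that contains a minimal projection, i.e. a nonzero projection `p`
whose only subprojections in the algebra are `0` and `p`. -/
def IsTypeIFactor (N : VonNeumannAlgebra H) : Prop :=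
  IsFactor N ∧ ∃ p ∈ N, IsStarProjection p ∧ p ≠ 0 ∧
    ∀ q ∈ N, IsStarProjection q → q ≤ p → q = 0 ∨ q = p

/-- Hyperfinite: generated, as a von Neumann algebra, by an increasing sequence of
finite-dimensional *-subalgebras. -/
def IsHyperfinite (A : VonNeumannAlgebra H) : Prop :=
  ∃ F : ℕ → StarSubalgebra ℂ (H →L[ℂ] H), Monotone F ∧ (∀ n, FiniteDimensional ℂ (F n)) ∧
    Set.centralizer (Set.centralizer (⋃ n, (F n : Set (H →L[ℂ] H)))) = (A : Set (H →L[ℂ] H))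

/-- σ-finite: every family of mutually orthogonal projections of the algebra is countable. -/
def IsSigmaFinite (A : VonNeumannAlgebra H) : Prop :=
  ∀ S : Set (H →L[ℂ] H), (∀ p ∈ S, p ∈ A ∧ IsStarProjection p) →
    (∀ p ∈ S, ∀ q ∈ S, p ≠ q → p * q = 0) → S.Countable

/-- A simple bipartite system: a bipartite system consisting of two hyperfinite and σ-finite
factors on `H`, with ambient algebra `B(H)`, which together generate `B(H)`. -/
structure IsSimpleBipartiteSystem (A B : VonNeumannAlgebra H) : Prop where
  bipartite : IsBipartiteSystem A.toStarSubalgebra B.toStarSubalgebra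
  factor_left : IsFactor A
  factor_right : IsFactor B
  hyperfinite_left : IsHyperfinite A
  hyperfinite_right : IsHyperfinite B
  sigmaFinite_left : IsSigmaFinite A
  sigmaFinite_right : IsSigmaFinite B
  generate : Set.centralizer (Set.centralizer
    ((A : Set (H →L[ℂ] H)) ∪ (B : Set (H →L[ℂ] H)))) = Set.univ

/-- The split property: some type I factor `N` contains `A` and is contained in the commutant of
`B`. -/
def HasSplitProperty (A B : VonNeumannAlgebra H) : Prop :=
  ∃ N : VonNeumannAlgebra H, IsTypeIFactor N ∧ A ≤ N ∧ N ≤ B.commutant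

end VonNeumann

end

/-! A type I factor `N` between `A` and `B'` supplies a total set of vectors that are product
vectors for `A` and `B`, and product vectors see almost nothing of a highly entangled pair.

Let `p` be a minimal projection of `N`. Then `p N p = ℂ p` (`exists_corner_eq_smul`), so for `u ∈ N`
and `v ∈ p H` the functional of `w = u v` factorizes over `N` and `N'`, hence over `A` and `B`. A
local operation pulls it back to a functional factorizing over the two qudits, whose overlap with
`χ_d` is at most `‖w‖² / d` by Cauchy–Schwarz (`re_map_maxEntangledProj_le`).

For local operations `T_d`, the effects `Q_d = T_d(|χ_d⟩⟨χ_d|)` therefore tend strongly to zero on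
each such `w`. These vectors span a dense subspace because `N` is a factor, and the effects are
bounded, so `Q_d → 0` strongly on `H`. Normality forces `ω(Q_d) → 0`, against `ω(Q_d) > 1/2`. -/

open Filter Topology

/-! ### Corners of a von Neumann algebra at a minimal projection. -/

section Corner

variable {H : Type*} [NormedAddCommGroup H] [InnerProductSpace ℂ H] [CompleteSpace H]

theorem VonNeumannAlgebra.posPart_mem (N : VonNeumannAlgebra H) {y : H →L[ℂ] H} (hy : y ∈ N)
    (hsa : IsSelfAdjoint y) : y⁺ ∈ N := by
  rw [← N.commutant_commutant, VonNeumannAlgebra.mem_commutant_iff]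
  intro z hz
  have hc : Commute y z := VonNeumannAlgebra.mem_commutant_iff.1 hz y hy
  exact (hsa.commute_cfcₙ hc _).symm.eq

/-- Since `y⁺ y⁺ = y⁺ y` and `y (1 - p) = 0`, the C*-identity gives `y⁺ (1 - p) = 0`. -/
theorem posPart_mul_of_mul_eq {M : Type*} [CStarAlgebra M] [PartialOrder M] [StarOrderedRing M]
    {y p : M} (hsa : IsSelfAdjoint y) (h : y * p = y) :
    y⁺ * p = y⁺ := by
  have hpos : IsSelfAdjoint y⁺ := (CFC.posPart_nonneg y).isSelfAdjoint
  have hyy : y⁺ * y = y⁺ * y⁺ := by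
    nth_rw 2 [← CFC.posPart_sub_negPart y hsa]
    rw [mul_sub, CFC.posPart_mul_negPart, sub_zero]
  have hz : star (y⁺ * (1 - p)) * (y⁺ * (1 - p)) = 0 := by
    rw [star_mul, hpos.star_eq, mul_assoc, ← mul_assoc y⁺ y⁺, ← hyy, mul_assoc y⁺, mul_sub, mul_one,
      h, sub_self, mul_zero, mul_zero]
  have := CStarRing.star_mul_self_eq_zero_iff _ |>.1 hz
  rw [mul_sub, mul_one, sub_eq_zero] at this
  exact this.symm

/-- The range projection of `y⁺` lies in `N` and below `p`, so by minimality it is `0` or `p`. In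
the first case `y⁺ = 0`. In the second `y⁻`, which kills the range of `y⁺`, kills `p H`, so `y⁻ = y⁻
p = 0`. -/
theorem nonneg_or_nonpos_of_minimal (N : VonNeumannAlgebra H) {p : H →L[ℂ] H}
    (hp : IsStarProjection p)
    (hmin : ∀ q ∈ N, IsStarProjection q → q ≤ p → q = 0 ∨ q = p)
    {y : H →L[ℂ] H} (hy : y ∈ N) (hsa : IsSelfAdjoint y) (hyp : y * p = y) :
    0 ≤ y ∨ y ≤ 0 := by
  have hpos : IsSelfAdjoint y⁺ := (CFC.posPart_nonneg y).isSelfAdjoint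
  have hpp : p * y⁺ = y⁺ := by
    have := congrArg star (posPart_mul_of_mul_eq hsa hyp)
    rwa [star_mul, hpos.star_eq, hp.isSelfAdjoint.star_eq] at this
  have hnp : y⁻ * p = y⁻ := by
    have := posPart_mul_of_mul_eq hsa.neg (by rw [neg_mul, hyp])
    rwa [CFC.posPart_neg] at this
  set K : Submodule ℂ H := (y⁺).range.topologicalClosure with hK
  have : CompleteSpace K := (Submodule.isClosed_topologicalClosure _).completeSpace_coe
  have hle (v : H) : y⁺ v ∈ K := Submodule.le_topologicalClosure _ ⟨v, rfl⟩
  have hq : IsStarProjection K.starProjection := isStarProjection_starProjection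
  have hqN : K.starProjection ∈ N := by
    rw [VonNeumannAlgebra.IsStarProjection.mem_iff hq]
    intro z hz
    rw [Submodule.range_starProjection, Module.End.mem_invtSubmodule]
    have hc : y⁺ * z = z * y⁺ :=
      VonNeumannAlgebra.mem_commutant_iff.1 hz _ (N.posPart_mem hy hsa)
    refine Submodule.topologicalClosure_minimal _ ?_
      ((Submodule.isClosed_topologicalClosure _).preimage z.continuous)
    rintro _ ⟨v, rfl⟩
    have : z (y⁺ v) = y⁺ (z v) := (congrArg (fun T : H →L[ℂ] H => T v) hc).symm
    change z (y⁺ v) ∈ K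
    rw [this]
    exact hle _
  have hqp : K.starProjection ≤ p := by
    obtain ⟨U, hU, rfl⟩ := isStarProjection_iff_eq_starProjection.1 hp
    rw [Submodule.starProjection_le_starProjection_iff]
    refine Submodule.topologicalClosure_minimal _ ?_ ?_
    · rintro _ ⟨v, rfl⟩
      have : U.starProjection (y⁺ v) = y⁺ v := congrArg (fun T : H →L[ℂ] H => T v) hpp
      exact Submodule.starProjection_eq_self_iff.1 this
    · have : (U : Set H) = {v | U.starProjection v = v} := by
        ext v; exact Submodule.starProjection_eq_self_iff.symm
      rw [this]
      exact isClosed_eq U.starProjection.continuous continuous_id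
  rcases hmin _ hqN hq hqp with h | h
  · right
    have h0 : y⁺ = 0 := by
      ext v
      have := Submodule.starProjection_eq_self_iff.2 (hle v)
      rw [h] at this
      exact this.symm
    rw [← CFC.posPart_sub_negPart y hsa, h0, zero_sub, neg_nonpos]
    exact CFC.negPart_nonneg y
  · left
    have h0 : y⁻ = 0 := by
      rw [← hnp, ← h]
      ext v
      have hker : ∀ x ∈ K, y⁻ x = 0 := by
        intro x hx
        have : K ≤ (y⁻).ker := by
          refine Submodule.topologicalClosure_minimal _ ?_ (y⁻).isClosed_ker
          rintro _ ⟨v, rfl⟩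
          exact congrArg (fun T : H →L[ℂ] H => T v) (CFC.negPart_mul_posPart y)
        exact this hx
      exact hker _ (Submodule.starProjection_apply_mem K v)
    rw [← CFC.posPart_sub_negPart y hsa, h0, sub_zero]
    exact CFC.posPart_nonneg y

/-- Connectedness of `ℝ` replaces spectral theory. Each `p x p - c p` has a sign, so two closed sets
of `c` cover the line; both are nonempty, as `c = ±‖x‖` shows, and at a common point the difference
vanishes. -/
theorem exists_corner_eq_smul_of_isSelfAdjoint (N : VonNeumannAlgebra H) {p : H →L[ℂ] H}
    (hpN : p ∈ N) (hp : IsStarProjection p)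
    (hmin : ∀ q ∈ N, IsStarProjection q → q ≤ p → q = 0 ∨ q = p)
    {x : H →L[ℂ] H} (hx : x ∈ N) (hsa : IsSelfAdjoint x) :
    ∃ c : ℝ, p * x * p = c • p := by
  have hpp : p * p = p := hp.isIdempotentElem
  have hps : star p = p := hp.isSelfAdjoint
  have hconj : IsSelfAdjoint (p * x * p) := by
    have := hsa.conjugate p
    rwa [hps] at this
  have hcont : Continuous fun c : ℝ => p * x * p - c • p := by fun_prop
  have hclosed : IsClosed {T : H →L[ℂ] H | 0 ≤ T} := CStarAlgebra.isClosed_nonneg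
  have h1 : IsClosed {c : ℝ | 0 ≤ p * x * p - c • p} := hclosed.preimage hcont
  have h2 : IsClosed {c : ℝ | 0 ≤ -(p * x * p - c • p)} := hclosed.preimage hcont.neg
  have hcov : (Set.univ : Set ℝ) ⊆
      {c : ℝ | 0 ≤ p * x * p - c • p} ∪ {c : ℝ | 0 ≤ -(p * x * p - c • p)} := by
    intro c _
    have hcN : c • p ∈ N := by
      rw [← Complex.coe_smul]
      exact N.toStarSubalgebra.smul_mem hpN (c : ℂ)
    have hyN : p * x * p - c • p ∈ N := sub_mem (mul_mem (mul_mem hpN hx) hpN) hcN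
    have hysa : IsSelfAdjoint (p * x * p - c • p) :=
      hconj.sub ((IsSelfAdjoint.all c).smul hp.isSelfAdjoint)
    have hyp : (p * x * p - c • p) * p = p * x * p - c • p := by
      rw [sub_mul, mul_assoc _ p p, smul_mul_assoc, hpp]
    have := nonneg_or_nonpos_of_minimal N hp hmin hyN hysa hyp
    rcases this with h | h
    · exact Or.inl h
    · exact Or.inr (neg_nonneg.2 h)
  have hlow : 0 ≤ p * x * p - (-‖x‖) • p := by
    have h := IsSelfAdjoint.neg_algebraMap_norm_le_self hsa
    have h' := star_left_conjugate_le_conjugate h p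
    rw [hps] at h'
    rw [sub_nonneg]
    convert h' using 1
    simp [Algebra.algebraMap_eq_smul_one, hpp]
  have hup : 0 ≤ -(p * x * p - ‖x‖ • p) := by
    have h := IsSelfAdjoint.le_algebraMap_norm_self hsa
    have h' := star_left_conjugate_le_conjugate h p
    rw [hps] at h'
    rw [neg_sub, sub_nonneg]
    convert h' using 1
    simp [Algebra.algebraMap_eq_smul_one, hpp]
  obtain ⟨c, -, hc1, hc2⟩ := isPreconnected_closed_iff.1 isPreconnected_univ _ _ h1 h2 hcov
    ⟨-‖x‖, trivial, hlow⟩ ⟨‖x‖, trivial, hup⟩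
  exact ⟨c, sub_eq_zero.1 (le_antisymm (neg_nonneg.1 hc2) hc1)⟩

theorem exists_corner_eq_smul (N : VonNeumannAlgebra H) {p : H →L[ℂ] H}
    (hpN : p ∈ N) (hp : IsStarProjection p)
    (hmin : ∀ q ∈ N, IsStarProjection q → q ≤ p → q = 0 ∨ q = p)
    {x : H →L[ℂ] H} (hx : x ∈ N) : ∃ c : ℂ, p * x * p = c • p := by
  have hre : (realPart x : H →L[ℂ] H) ∈ N := by
    rw [realPart_apply_coe, ← Complex.coe_smul]
    exact N.toStarSubalgebra.smul_mem (add_mem hx (star_mem hx)) _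
  have him : (imaginaryPart x : H →L[ℂ] H) ∈ N := by
    rw [imaginaryPart_apply_coe, ← Complex.coe_smul]
    exact N.toStarSubalgebra.smul_mem (N.toStarSubalgebra.smul_mem (sub_mem hx (star_mem hx)) _) _
  obtain ⟨a, ha⟩ := exists_corner_eq_smul_of_isSelfAdjoint N hpN hp hmin hre (realPart x).2
  obtain ⟨b, hb⟩ := exists_corner_eq_smul_of_isSelfAdjoint N hpN hp hmin him (imaginaryPart x).2
  refine ⟨a + Complex.I * b, ?_⟩
  conv_lhs => rw [← realPart_add_I_smul_imaginaryPart x]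
  rw [mul_add, add_mul, ha, mul_smul_comm, smul_mul_assoc, hb, add_smul, mul_smul]
  rfl

end Corner

/-! ### Product functionals and the maximally entangled state. -/

section Fidelity

theorem PositiveLinearMap.norm_map_star_mul_sq_le {M : Type*} [CStarAlgebra M] [PartialOrder M]
    [StarOrderedRing M] (φ : M →ₚ[ℂ] ℂ) (a b : M) :
    ‖φ (star a * b)‖ ≤ √(φ (star a * a)).re * √(φ (star b * b)).re := by
  have h := norm_inner_le_norm (𝕜 := ℂ) (φ.toPreGNS a) (φ.toPreGNS b)
  rw [φ.preGNS_inner_def, φ.preGNS_norm_def, φ.preGNS_norm_def] at h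
  exact h

/-- Cauchy–Schwarz for `e_ij = e_ii* e_ij`, with `e_ij* e_ij = e_jj`. -/
theorem norm_map_hom_single_le {M : Type*} [CStarAlgebra M] [PartialOrder M]
    [StarOrderedRing M] {d : ℕ} (φ : M →ₚ[ℂ] ℂ) (f : Matrix (Fin d) (Fin d) ℂ →⋆ₐ[ℂ] M)
    (i j : Fin d) :
    ‖φ (f (Matrix.single i j 1))‖ ≤
      √(φ (f (Matrix.single i i 1))).re * √(φ (f (Matrix.single j j 1))).re := by
  have h := φ.norm_map_star_mul_sq_le (f (Matrix.single i i 1)) (f (Matrix.single i j 1))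
  have key (k l m : Fin d) : star (f (Matrix.single k l 1)) * f (Matrix.single k m 1) =
      f (Matrix.single l m 1) := by
    rw [← map_star, ← map_mul, Matrix.star_eq_conjTranspose, Matrix.conjTranspose_single, star_one,
      Matrix.single_mul_single_same, mul_one]
  rwa [key, key, key] at h

theorem sum_map_hom_single {M : Type*} [CStarAlgebra M] [PartialOrder M]
    [StarOrderedRing M] {d : ℕ} (φ : M →ₚ[ℂ] ℂ) (f : Matrix (Fin d) (Fin d) ℂ →⋆ₐ[ℂ] M) :
    ∑ i, (φ (f (Matrix.single i i 1))).re = (φ 1).re := by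
  rw [← Complex.re_sum, ← map_sum, ← map_sum, ← map_one f]
  congr 3
  ext i j
  simp [Matrix.sum_apply, Matrix.single_apply, Matrix.one_apply, ite_and]

theorem re_map_hom_single_nonneg {M : Type*} [CStarAlgebra M] [PartialOrder M]
    [StarOrderedRing M] {d : ℕ} (φ : M →ₚ[ℂ] ℂ) (f : Matrix (Fin d) (Fin d) ℂ →⋆ₐ[ℂ] M)
    (i : Fin d) : 0 ≤ (φ (f (Matrix.single i i 1))).re := by
  have h : f (Matrix.single i i 1) = star (f (Matrix.single i i 1)) * f (Matrix.single i i 1) := by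
    rw [← map_star, ← map_mul, Matrix.star_eq_conjTranspose, Matrix.conjTranspose_single, star_one,
      Matrix.single_mul_single_same, mul_one]
  rw [h]
  exact (Complex.nonneg_iff.1 (map_nonneg φ (star_mul_self_nonneg _))).1

/-- Each `e_ij ⊗ e_ij` is `|ii⟩⟨jj|`. Writing the projection as a sum of products lets factorization
be applied term by term. -/
theorem maxEntangledProj_eq (d : ℕ) : maxEntangledProj d =
    ((1 / d : ℝ) : ℂ) • ∑ i : Fin d, ∑ j : Fin d,
      leftEmbed d (Matrix.single i j 1) * rightEmbed d (Matrix.single i j 1) := by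
  have hLR (i j : Fin d) :
      leftEmbed d (Matrix.single i j 1) * rightEmbed d (Matrix.single i j 1) =
        InnerProductSpace.rankOne ℂ (EuclideanSpace.single (i, i) (1 : ℂ) : TwoQudit d)
          (EuclideanSpace.single (j, j) (1 : ℂ)) := by
    have h : leftEmbed d (Matrix.single i j 1) * rightEmbed d (Matrix.single i j 1) =
        Matrix.toEuclideanCLM (n := Fin d × Fin d) (𝕜 := ℂ) (Matrix.single (i, i) (j, j) 1) := by
      change Matrix.toEuclideanCLM (n := Fin d × Fin d) (𝕜 := ℂ) _ *
        Matrix.toEuclideanCLM (n := Fin d × Fin d) (𝕜 := ℂ) _ = _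
      rw [← map_mul]
      congr 1
      change (Matrix.single i j (1 : ℂ) ⊗ₖ (1 : Matrix (Fin d) (Fin d) ℂ)) *
        ((1 : Matrix (Fin d) (Fin d) ℂ) ⊗ₖ Matrix.single i j (1 : ℂ)) = _
      rw [← Matrix.mul_kronecker_mul, one_mul, mul_one, Matrix.single_kronecker_single, one_mul]
    rw [h]
    ext v k
    rw [Matrix.ofLp_toEuclideanCLM]
    simp [Matrix.single_mulVec, InnerProductSpace.rankOne_apply, Function.update_apply,
      EuclideanSpace.inner_single_left]
  have hd : (((1 / √(d : ℝ) : ℝ) : ℂ)) * ((1 / √(d : ℝ) : ℝ) : ℂ) = ((1 / d : ℝ) : ℂ) := by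
    rw [← Complex.ofReal_mul, div_mul_div_comm, one_mul, Real.mul_self_sqrt (Nat.cast_nonneg d)]
  simp_rw [hLR]
  rw [maxEntangledProj, maxEntangledVector]
  simp only [map_smul, map_sum, smul_apply, sum_apply,
    map_smulₛₗ, Complex.conj_ofReal]
  rw [← Finset.smul_sum, smul_smul, hd, Finset.sum_comm]

theorem norm_maxEntangledVector {d : ℕ} (hd : d ≠ 0) : ‖maxEntangledVector d‖ = 1 := by
  have h : ‖∑ j : Fin d, (EuclideanSpace.single (j, j) (1 : ℂ) : TwoQudit d)‖ ^ 2 = d := by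
    have ho : Orthonormal ℂ fun j : Fin d => (EuclideanSpace.single (j, j) (1 : ℂ) : TwoQudit d) :=
      (EuclideanSpace.orthonormal_single (𝕜 := ℂ) (ι := Fin d × Fin d)).comp (fun j => (j, j))
        fun a b h => (Prod.mk.inj h).1
    have := ho.inner_sum (fun _ => (1 : ℂ)) (fun _ => (1 : ℂ)) Finset.univ
    simp only [one_smul, inner_self_eq_norm_sq_to_K] at this
    have h' : ((‖∑ j : Fin d, (EuclideanSpace.single (j, j) (1 : ℂ) : TwoQudit d)‖ ^ 2 : ℝ) : ℂ)
        = ((d : ℝ) : ℂ) := by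
      push_cast
      exact this.trans (by simp)
    exact_mod_cast h'
  have hd' : (0 : ℝ) < √d := Real.sqrt_pos.2 (by positivity)
  rw [maxEntangledVector, norm_smul, ← Real.sqrt_sq (norm_nonneg (∑ j : Fin d, _)), h,
    Complex.norm_real, Real.norm_of_nonneg (by positivity), one_div, inv_mul_cancel₀ hd'.ne']

theorem isStarProjection_maxEntangledProj {d : ℕ} (hd : d ≠ 0) :
    IsStarProjection (maxEntangledProj d) :=
  InnerProductSpace.isStarProjection_rankOne_self (norm_maxEntangledVector hd)

/-- A positive functional which factorizes over the two parties has fidelity at most `1 / d` with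
the maximally entangled state. -/
theorem re_map_maxEntangledProj_le {d : ℕ} (hd : d ≠ 0)
    (φ : (TwoQudit d →L[ℂ] TwoQudit d) →ₚ[ℂ] ℂ)
    (hφ : ∀ a ∈ leftAlgebra d, ∀ b ∈ rightAlgebra d, φ (a * b) * φ 1 = φ a * φ b) :
    (φ (maxEntangledProj d)).re ≤ (φ 1).re / d := by
  have h1 := Complex.nonneg_iff.1 (map_nonneg φ (zero_le_one' (TwoQudit d →L[ℂ] TwoQudit d)))
  have hle : (φ (maxEntangledProj d)).re ≤ (φ 1).re :=
    (Complex.le_def.1 (OrderHomClass.mono φ (isStarProjection_maxEntangledProj hd).le_one)).1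
  -- The factorization hypothesis is homogeneous and says nothing when `φ 1 = 0`; there monotonicity
  -- suffices.
  rcases h1.1.eq_or_lt with h0 | hpos
  · rw [← h0] at hle ⊢
    simpa using hle
  set a : Fin d → ℝ := fun i => (φ (leftEmbed d (Matrix.single i i 1))).re
  set b : Fin d → ℝ := fun i => (φ (rightEmbed d (Matrix.single i i 1))).re
  -- Cauchy–Schwarz twice: for each matrix unit, which splits the double sum into a square, then
  -- over the index `i`, where the diagonal values sum to `φ 1`.
  have hbound : ‖∑ i : Fin d, ∑ j : Fin d, φ (leftEmbed d (Matrix.single i j 1)) *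
      φ (rightEmbed d (Matrix.single i j 1))‖ ≤ (φ 1).re * (φ 1).re := by
    calc _ ≤ ∑ i : Fin d, ∑ j : Fin d, (√(a i) * √(a j)) * (√(b i) * √(b j)) := by
          refine (norm_sum_le _ _).trans (Finset.sum_le_sum fun i _ =>
            (norm_sum_le _ _).trans (Finset.sum_le_sum fun j _ => ?_))
          rw [norm_mul]
          exact mul_le_mul (norm_map_hom_single_le φ _ i j) (norm_map_hom_single_le φ _ i j)
            (norm_nonneg _) (by positivity)
      _ = (∑ i, √(a i) * √(b i)) * ∑ i, √(a i) * √(b i) := by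
          rw [Finset.sum_mul_sum]
          exact Finset.sum_congr rfl fun i _ => Finset.sum_congr rfl fun j _ => by ring
      _ ≤ (√(∑ i, a i) * √(∑ i, b i)) * (√(∑ i, a i) * √(∑ i, b i)) := by
          have := Real.sum_sqrt_mul_sqrt_le Finset.univ
            (fun i => re_map_hom_single_nonneg φ (leftEmbed d) i)
            (fun i => re_map_hom_single_nonneg φ (rightEmbed d) i)
          exact mul_self_le_mul_self (Finset.sum_nonneg fun i _ => by positivity) this
      _ = (φ 1).re * (φ 1).re := by
          rw [sum_map_hom_single, sum_map_hom_single, Real.mul_self_sqrt h1.1]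
  have hprod : φ (maxEntangledProj d) * φ 1 = ((1 / d : ℝ) : ℂ) *
      ∑ i : Fin d, ∑ j : Fin d, φ (leftEmbed d (Matrix.single i j 1)) *
        φ (rightEmbed d (Matrix.single i j 1)) := by
    rw [maxEntangledProj_eq, map_smul, smul_eq_mul, mul_assoc, map_sum, Finset.sum_mul]
    congr 1
    refine Finset.sum_congr rfl fun i _ => ?_
    rw [map_sum, Finset.sum_mul]
    exact Finset.sum_congr rfl fun j _ => hφ _ ⟨_, rfl⟩ _ ⟨_, rfl⟩
  have hre : (φ (maxEntangledProj d)).re * (φ 1).re ≤ (1 / d : ℝ) * ((φ 1).re * (φ 1).re) := by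
    have h2 : (φ (maxEntangledProj d) * φ 1).re = (φ (maxEntangledProj d)).re * (φ 1).re := by
      rw [Complex.mul_re, ← h1.2, mul_zero, sub_zero]
    rw [← h2, hprod]
    refine (Complex.re_le_norm _).trans ?_
    rw [norm_mul, Complex.norm_real, Real.norm_of_nonneg (by positivity)]
    gcongr
  have : (φ (maxEntangledProj d)).re * (φ 1).re ≤ ((φ 1).re / d) * (φ 1).re := by
    calc _ ≤ _ := hre
      _ = _ := by ring
  exact le_of_mul_le_mul_right this hpos

end Fidelity

/-! ### Normal functionals and strong convergence of effects. -/

section Normal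

variable {H : Type*} [NormedAddCommGroup H] [InnerProductSpace ℂ H] [CompleteSpace H]

/-- The projections onto finite-dimensional subspaces have supremum `1`. -/
theorem isLUB_starProjection_finiteDimensional :
    IsLUB {P : H →L[ℂ] H | ∃ (K : Submodule ℂ H) (_ : FiniteDimensional ℂ K),
      P = K.starProjection} 1 := by
  constructor
  · rintro _ ⟨K, _, rfl⟩
    exact isStarProjection_starProjection.le_one
  · intro x hx
    have h0 : 0 ≤ x := by
      have := hx ⟨⊥, inferInstance, rfl⟩
      rwa [Submodule.starProjection_bot] at this
    rw [ContinuousLinearMap.le_def, ContinuousLinearMap.isPositive_def']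
    refine ⟨h0.isSelfAdjoint.sub (IsSelfAdjoint.one _), fun v => ?_⟩
    -- The upper bound is tested at `v` against the projection onto the line through `v`.
    have h := ((ContinuousLinearMap.le_def _ _).1
      (hx ⟨ℂ ∙ v, inferInstance, rfl⟩)).re_inner_nonneg_left v
    have hv : (ℂ ∙ v).starProjection v = v :=
      Submodule.starProjection_eq_self_iff.2 (Submodule.mem_span_singleton_self v)
    simpa [ContinuousLinearMap.reApplyInnerSelf, hv] using h

theorem IsNormalFunctional.exists_finiteDimensional {ω : (H →L[ℂ] H) →ₚ[ℂ] ℂ}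
    (hω : IsNormalFunctional ω) {δ : ℝ} (hδ : 0 < δ) :
    ∃ (K : Submodule ℂ H) (_ : FiniteDimensional ℂ K),
      (ω 1).re - δ < (ω K.starProjection).re := by
  have h := hω {P | ∃ (K : Submodule ℂ H) (_ : FiniteDimensional ℂ K), P = K.starProjection} 1
    ⟨0, ⊥, inferInstance, Submodule.starProjection_bot.symm⟩ ?_ ?_
    isLUB_starProjection_finiteDimensional
  · obtain ⟨_, ⟨_, ⟨K, hK, rfl⟩, rfl⟩, hlt, -⟩ := h.exists_between (sub_lt_self (ω 1).re hδ)
    exact ⟨K, hK, hlt⟩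
  · rintro _ ⟨K, hK, rfl⟩ _ ⟨L, hL, rfl⟩
    refine ⟨_, ⟨K ⊔ L, inferInstance, rfl⟩, ?_, ?_⟩
    · exact Submodule.starProjection_le_starProjection_iff.2 le_sup_left
    · exact Submodule.starProjection_le_starProjection_iff.2 le_sup_right
  · rintro _ ⟨K, _, rfl⟩
    exact isSelfAdjoint_starProjection K

/-- In an orthonormal basis of `K` the product is a finite sum of operators `|Q_n e_i⟩⟨e_i|`, so
strong convergence becomes norm convergence. -/
theorem tendsto_mul_starProjection {Q : ℕ → H →L[ℂ] H}
    (hQ : ∀ v, Tendsto (fun n => Q n v) atTop (𝓝 0)) (K : Submodule ℂ H) [FiniteDimensional ℂ K] :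
    Tendsto (fun n => Q n * K.starProjection) atTop (𝓝 0) := by
  have h (n : ℕ) : Q n * K.starProjection = ∑ i, InnerProductSpace.rankOne ℂ
      (Q n (stdOrthonormalBasis ℂ K i : H)) (stdOrthonormalBasis ℂ K i : H) := by
    rw [(stdOrthonormalBasis ℂ K).starProjection_eq_sum_rankOne, Finset.mul_sum]
    refine Finset.sum_congr rfl fun i _ => ?_
    ext v
    simp
  simp_rw [h]
  rw [← Finset.sum_const_zero (s := Finset.univ) (ι := Fin (Module.finrank ℂ K))]
  refine tendsto_finsetSum _ fun i _ => ?_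
  rw [tendsto_zero_iff_norm_tendsto_zero]
  simp only [InnerProductSpace.norm_rankOne]
  simpa using (hQ _).norm.mul_const _

/-- Adding the positive operator `(P - P⊥) Q (P - P⊥)` to `Q` cancels the cross terms and leaves `2
P Q P + 2 P⊥ Q P⊥`, where `P⊥ = 1 - P`; then `P⊥ Q P⊥ ≤ P⊥`. -/
theorem le_two_smul_conjugate_add {Q P : H →L[ℂ] H} (hQ : 0 ≤ Q) (hQ1 : Q ≤ 1)
    (hP : IsStarProjection P) :
    Q ≤ (2 : ℝ) • (P * Q * P) + (2 : ℝ) • (1 - P) := by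
  have hps : star P = P := hP.isSelfAdjoint
  have hps' : star (1 - P) = 1 - P := by rw [star_sub, star_one, hps]
  have h1 : 0 ≤ (P - (1 - P)) * Q * (P - (1 - P)) := by
    have := star_left_conjugate_nonneg hQ (P - (1 - P))
    rwa [star_sub, hps', hps] at this
  have h2 : (1 - P) * Q * (1 - P) ≤ 1 - P := by
    have := star_left_conjugate_le_conjugate hQ1 (1 - P)
    rwa [hps', mul_one, hP.one_sub.isIdempotentElem] at this
  have h3 : (2 : ℝ) • ((1 - P) * Q * (1 - P)) ≤ (2 : ℝ) • (1 - P) :=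
    smul_le_smul_of_nonneg_left h2 zero_le_two
  have h4 : Q + (P - (1 - P)) * Q * (P - (1 - P)) =
      (2 : ℝ) • (P * Q * P) + (2 : ℝ) • ((1 - P) * Q * (1 - P)) := by
    simp only [two_smul]
    noncomm_ring
  calc Q ≤ Q + (P - (1 - P)) * Q * (P - (1 - P)) := le_add_of_nonneg_right h1
    _ = _ := h4
    _ ≤ _ := by gcongr

/-- A normal state is continuous along bounded, strongly convergent sequences of effects. -/
theorem IsNormalFunctional.exists_re_lt {ω : (H →L[ℂ] H) →ₚ[ℂ] ℂ}
    (hω : IsNormalFunctional ω) {Q : ℕ → H →L[ℂ] H} (h0 : ∀ n, 0 ≤ Q n) (h1 : ∀ n, Q n ≤ 1)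
    (hQ : ∀ v, Tendsto (fun n => Q n v) atTop (𝓝 0)) {ε : ℝ} (hε : 0 < ε) :
    ∀ᶠ n in atTop, (ω (Q n)).re < ε := by
  -- Both terms of the bound on `Q` carry a factor `2`, hence `ε / 4` for each.
  obtain ⟨K, hK, hlt⟩ := hω.exists_finiteDimensional (show 0 < ε / 4 by positivity)
  have hcont : Continuous ω := map_continuous ω
  have hlim : Tendsto (fun n => (ω (K.starProjection * Q n * K.starProjection)).re)
      atTop (𝓝 0) := by
    have := (tendsto_mul_starProjection hQ K).const_mul K.starProjection
    simp only [mul_zero, ← mul_assoc] at this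
    have := (Complex.continuous_re.tendsto _).comp ((hcont.tendsto _).comp this)
    rw [map_zero, Complex.zero_re] at this
    exact this
  filter_upwards [hlim.eventually_lt_const (show 0 < ε / 4 by positivity)] with n hn
  have hle := (Complex.le_def.1 (OrderHomClass.mono ω
    (le_two_smul_conjugate_add (h0 n) (h1 n) (isStarProjection_starProjection (U := K))))).1
  simp only [← Complex.coe_smul (2 : ℝ)] at hle
  rw [map_add, map_smul, map_smul, map_sub, Complex.add_re, smul_eq_mul, smul_eq_mul,
    Complex.re_ofReal_mul, Complex.re_ofReal_mul, Complex.sub_re] at hle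
  linarith

/-- An effect satisfies `Q² ≤ Q`. This upgrades decay of expectation values to strong convergence.
-/
theorem norm_apply_sq_le_re_inner {Q : H →L[ℂ] H} (h0 : 0 ≤ Q) (h1 : Q ≤ 1) (v : H) :
    ‖Q v‖ ^ 2 ≤ (⟪v, Q v⟫_ℂ).re := by
  have hsq : Q * Q ≤ Q := by
    have := CStarAlgebra.pow_antitone h0 h1 (show 1 ≤ 2 by norm_num)
    simpa [pow_two] using this
  have h := ((ContinuousLinearMap.le_def _ _).1 hsq).re_inner_nonneg_right v
  have hs : ⟪v, Q (Q v)⟫_ℂ = ⟪Q v, Q v⟫_ℂ :=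
    ((ContinuousLinearMap.nonneg_iff_isPositive _).1 h0).isSymmetric v (Q v) |>.symm
  rw [sub_apply, inner_sub_right, map_sub, show (Q * Q) v = Q (Q v) from rfl, hs,
    inner_self_eq_norm_sq] at h
  exact sub_nonneg.1 h

omit [CompleteSpace H] in
/-- Strong convergence to zero of a bounded sequence may be tested on a total set. -/
theorem tendsto_apply_zero_of_dense_span {Q : ℕ → H →L[ℂ] H} {S : Set H}
    (hb : ∀ n, ‖Q n‖ ≤ 1) (hQ : ∀ v ∈ S, Tendsto (fun n => Q n v) atTop (𝓝 0))
    (hS : (Submodule.span ℂ S).topologicalClosure = ⊤) (v : H) :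
    Tendsto (fun n => Q n v) atTop (𝓝 0) := by
  have hspan : ∀ w ∈ Submodule.span ℂ S, Tendsto (fun n => Q n w) atTop (𝓝 0) := by
    intro w hw
    induction hw using Submodule.span_induction with
    | mem x hx => exact hQ x hx
    | zero => simp
    | add x y _ _ hx hy => simpa using hx.add hy
    | smul c x _ hx => simpa using hx.const_smul c
  rw [Metric.tendsto_atTop]
  intro ε hε
  have hv : v ∈ closure (Submodule.span ℂ S : Set H) := by
    rw [← Submodule.topologicalClosure_coe, hS]; trivial
  obtain ⟨w, hw, hvw⟩ := Metric.mem_closure_iff.1 hv (ε / 2) (by positivity)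
  obtain ⟨n₀, hn₀⟩ := Metric.tendsto_atTop.1 (hspan w hw) (ε / 2) (by positivity)
  refine ⟨n₀, fun n hn => ?_⟩
  have h1 := hn₀ n hn
  rw [dist_zero_right] at h1 ⊢
  have h2 : ‖Q n (v - w)‖ ≤ 1 * ‖v - w‖ := (Q n).le_of_opNorm_le (hb n) _
  rw [dist_eq_norm] at hvw
  calc ‖Q n v‖ = ‖Q n (v - w) + Q n w‖ := by rw [← map_add, sub_add_cancel]
    _ ≤ ‖Q n (v - w)‖ + ‖Q n w‖ := norm_add_le _ _
    _ < ε := by linarith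

end Normal

/-! ### Product vectors from a minimal projection, and their density. -/

section Product

variable {H : Type*} [NormedAddCommGroup H] [InnerProductSpace ℂ H] [CompleteSpace H]

/-- The positive functional `x ↦ ⟪w, x w⟫` on `B(H)`. -/
noncomputable def vectorFunctional (w : H) : (H →L[ℂ] H) →ₚ[ℂ] ℂ :=
  PositiveLinearMap.mk₀
    { toFun := fun x => ⟪w, x w⟫_ℂ
      map_add' := fun x y => by rw [add_apply, inner_add_right]
      map_smul' := fun c x => by rw [smul_apply, inner_smul_right]; rfl }
    fun x hx => ((ContinuousLinearMap.nonneg_iff_isPositive x).1 hx).inner_nonneg_right w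

theorem vectorFunctional_apply (w : H) (x : H →L[ℂ] H) :
    vectorFunctional w x = ⟪w, x w⟫_ℂ := rfl

/-- For a minimal projection `p` of `N`, the vectors `u v` with `u ∈ N`, `v ∈ p H` are product
vectors for the pair `N`, `N'`. -/
theorem vectorFunctional_mul_of_minimal (N : VonNeumannAlgebra H) {p : H →L[ℂ] H}
    (hpN : p ∈ N) (hp : IsStarProjection p)
    (hmin : ∀ q ∈ N, IsStarProjection q → q ≤ p → q = 0 ∨ q = p)
    {u : H →L[ℂ] H} (hu : u ∈ N) {v : H} (hv : p v = v) {m n : H →L[ℂ] H} (hm : m ∈ N)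
    (hn : n ∈ N.commutant) :
    vectorFunctional (u v) (m * n) * vectorFunctional (u v) 1 =
      vectorFunctional (u v) m * vectorFunctional (u v) n := by
  -- Here `p u* x u p = c p`, while `y ∈ N'` commutes with `u` and `p`; so `x` enters only through
  -- the scalar `c`.
  have hcorner {x : H →L[ℂ] H} (hx : x ∈ N) :
      ∃ c : ℂ, ∀ y ∈ N.commutant, vectorFunctional (u v) (x * y) = c * ⟪v, y v⟫_ℂ := by
    obtain ⟨c, hc⟩ := exists_corner_eq_smul N hpN hp hmin (mul_mem (mul_mem (star_mem hu) hx) hu)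
    refine ⟨c, fun y hy => ?_⟩
    rw [VonNeumannAlgebra.mem_commutant_iff] at hy
    have hyu : y (u v) = u (y v) := (congrArg (fun T : H →L[ℂ] H => T v) (hy u hu)).symm
    have hyp : p (y v) = y v := by
      have : p (y v) = y (p v) := congrArg (fun T : H →L[ℂ] H => T v) (hy p hpN)
      rw [this, hv]
    have hc' : p ((star u) (x (u (p (y v))))) = c • p (y v) :=
      congrArg (fun T : H →L[ℂ] H => T (y v)) hc
    rw [hyp] at hc'
    have hps (a b : H) : ⟪p a, b⟫_ℂ = ⟪a, p b⟫_ℂ :=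
      (ContinuousLinearMap.isSelfAdjoint_iff_isSymmetric.1 hp.isSelfAdjoint) a b
    have hus (a b : H) : ⟪u a, b⟫_ℂ = ⟪a, (star u) b⟫_ℂ :=
      (ContinuousLinearMap.adjoint_inner_right u a b).symm
    calc vectorFunctional (u v) (x * y) = ⟪u v, x (y (u v))⟫_ℂ := rfl
      _ = ⟪v, (star u) (x (u (y v)))⟫_ℂ := by rw [hyu, hus]
      _ = ⟪p v, (star u) (x (u (y v)))⟫_ℂ := by rw [hv]
      _ = c * ⟪v, y v⟫_ℂ := by rw [hps, hc', inner_smul_right]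
  obtain ⟨c, hc⟩ := hcorner hm
  obtain ⟨e, he⟩ := hcorner (one_mem N)
  have h1 := hc 1 (one_mem _)
  have h2 := he n hn
  have h3 := he 1 (one_mem _)
  rw [mul_one] at h1 h3
  rw [one_mul] at h2
  rw [hc n hn, h1, h2, h3]
  ring

/-- In a factor, the subspace `N p H` is dense for every nonzero projection `p`. -/
theorem IsFactor.span_topologicalClosure_eq_top {N : VonNeumannAlgebra H} (hN : IsFactor N)
    {p : H →L[ℂ] H} (hpN : p ∈ N) (hp : IsStarProjection p) (hp0 : p ≠ 0) :
    (Submodule.span ℂ {w : H | ∃ u ∈ N, ∃ v, p v = v ∧ w = u v}).topologicalClosure = ⊤ := by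
  set S : Set H := {w : H | ∃ u ∈ N, ∃ v, p v = v ∧ w = u v}
  set K : Submodule ℂ H := (Submodule.span ℂ S).topologicalClosure with hK
  have : CompleteSpace K := (Submodule.isClosed_topologicalClosure _).completeSpace_coe
  -- The set `S` is stable under both `N` and `N'`, so the projection onto `K` is central, hence a
  -- scalar; it fixes a nonzero vector of `p H`, so the scalar is `1`.
  have hinv (z : H →L[ℂ] H) (hz : ∀ w ∈ S, z w ∈ S) : K ∈ Module.End.invtSubmodule z := by
    rw [Module.End.mem_invtSubmodule]
    refine Submodule.topologicalClosure_minimal _ (Submodule.span_le.2 fun w hw => ?_)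
      ((Submodule.isClosed_topologicalClosure _).preimage z.continuous)
    exact Submodule.le_topologicalClosure _ (Submodule.subset_span (hz w hw))
  have hq : IsStarProjection K.starProjection := isStarProjection_starProjection
  have hqN : K.starProjection ∈ N := by
    rw [VonNeumannAlgebra.IsStarProjection.mem_iff hq]
    intro z hz
    rw [VonNeumannAlgebra.mem_commutant_iff] at hz
    rw [Submodule.range_starProjection]
    refine hinv z ?_
    rintro _ ⟨u, hu, v, hv, rfl⟩
    refine ⟨u, hu, z v, ?_, ?_⟩
    · have : p (z v) = z (p v) := congrArg (fun T : H →L[ℂ] H => T v) (hz p hpN)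
      rw [this, hv]
    · exact (congrArg (fun T : H →L[ℂ] H => T v) (hz u hu)).symm
  have hqN' : K.starProjection ∈ N.commutant := by
    rw [VonNeumannAlgebra.IsStarProjection.mem_iff hq, VonNeumannAlgebra.commutant_commutant]
    intro z hz
    rw [Submodule.range_starProjection]
    refine hinv z ?_
    rintro _ ⟨u, hu, v, hv, rfl⟩
    exact ⟨z * u, mul_mem hz hu, v, hv, rfl⟩
  obtain ⟨c, hc⟩ := hN _ hqN hqN'
  obtain ⟨v, hv⟩ : ∃ v, p v ≠ 0 := by
    by_contra! h
    exact hp0 (ContinuousLinearMap.ext h)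
  have hpv : p (p v) = p v := congrArg (fun T : H →L[ℂ] H => T v) hp.isIdempotentElem
  have hmem : p v ∈ K := Submodule.le_topologicalClosure _
    (Submodule.subset_span ⟨1, one_mem N, p v, hpv, rfl⟩)
  have hcv : c • p v = p v := by
    have := Submodule.starProjection_eq_self_iff.2 hmem
    rwa [hc] at this
  have hc1 : c = 1 := by
    have : (c - 1) • p v = 0 := by rw [sub_smul, one_smul, hcv, sub_self]
    exact sub_eq_zero.1 ((smul_eq_zero.1 this).resolve_right hv)
  rw [eq_top_iff]
  intro x _
  rw [← Submodule.starProjection_eq_self_iff, hc, hc1, one_smul]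
  rfl

/-- Composing the functional of `w` with `T` preserves factorization and, `T` being unital, the
total mass `‖w‖²`. -/
theorem IsLocalOperation.re_inner_le {A B : StarSubalgebra ℂ (H →L[ℂ] H)} {d : ℕ} (hd : d ≠ 0)
    {T : (TwoQudit d →L[ℂ] TwoQudit d) →CP (H →L[ℂ] H)}
    (hT : IsLocalOperation (leftAlgebra d) (rightAlgebra d) A B T) {w : H}
    (hw : ∀ m ∈ A, ∀ n ∈ B, vectorFunctional w (m * n) * vectorFunctional w 1 =
      vectorFunctional w m * vectorFunctional w n) :
    (⟪w, T (maxEntangledProj d) w⟫_ℂ).re ≤ ‖w‖ ^ 2 / d := by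
  let φ : (TwoQudit d →L[ℂ] TwoQudit d) →ₚ[ℂ] ℂ :=
    PositiveLinearMap.mk₀ ((vectorFunctional w).toLinearMap ∘ₗ T.toLinearMap) fun x hx =>
      map_nonneg (vectorFunctional w) (map_nonneg T hx)
  have hφ (x : TwoQudit d →L[ℂ] TwoQudit d) : φ x = vectorFunctional w (T x) := rfl
  have h := re_map_maxEntangledProj_le hd φ fun a ha b hb => by
    rw [hφ, hφ, hφ, hφ, hT.map_one, hT.map_mul a ha b hb]
    exact hw _ (hT.map_left a ha) _ (hT.map_right b hb)
  rw [hφ, hφ, hT.map_one, vectorFunctional_apply, vectorFunctional_apply] at h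
  have hn : (⟪w, (1 : H →L[ℂ] H) w⟫_ℂ).re = ‖w‖ ^ 2 := inner_self_eq_norm_sq (𝕜 := ℂ) w
  rwa [hn] at h

end Product

/-! ### The main theorem. -/

theorem mainTheorem9 {H : Type*} [NormedAddCommGroup H] [InnerProductSpace ℂ H] [CompleteSpace H]
    (A B : VonNeumannAlgebra H) (hAB : IsSimpleBipartiteSystem A B)
    (hsplit : HasSplitProperty A B) :
    ¬ ∃ ω : (H →L[ℂ] H) →ₚ[ℂ] ℂ, IsState ω ∧ IsNormalFunctional ω ∧
      HasInfiniteOneCopyEntanglement A.toStarSubalgebra B.toStarSubalgebra ω := by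
  rintro ⟨ω, -, hnormal, hent⟩
  obtain ⟨N, ⟨hfactor, p, hpN, hp, hp0, hmin⟩, hAN, hNB⟩ := hsplit
  have hBN : B ≤ N.commutant := fun b hb => VonNeumannAlgebra.mem_commutant_iff.2 fun n hn =>
    (VonNeumannAlgebra.mem_commutant_iff.1 (hNB hn) b hb).symm
  -- The shift gives dimensions `d = n + 2 ≥ 2`; the single tolerance `1/2` already yields a
  -- contradiction as `d` grows.
  choose T hT hlt using fun n : ℕ => hent (n + 2) (Nat.le_add_left 2 n) (1 / 2) one_half_pos
  set Q : ℕ → H →L[ℂ] H := fun n => T n (maxEntangledProj (n + 2))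
  have hproj (n : ℕ) : IsStarProjection (maxEntangledProj (n + 2)) :=
    isStarProjection_maxEntangledProj (by omega)
  have hQ0 (n : ℕ) : 0 ≤ Q n := map_nonneg (T n) (hproj n).nonneg
  have hQ1 (n : ℕ) : Q n ≤ 1 :=
    (OrderHomClass.mono (T n) (hproj n).le_one).trans_eq (hT n).map_one
  have hQnorm (n : ℕ) : ‖Q n‖ ≤ 1 := (CStarAlgebra.norm_le_one_iff_of_nonneg _ (hQ0 n)).2 (hQ1 n)
  have hprod : ∀ w ∈ {w : H | ∃ u ∈ N, ∃ v, p v = v ∧ w = u v},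
      Tendsto (fun n => Q n w) atTop (𝓝 0) := by
    rintro w ⟨u, hu, v, hv, rfl⟩
    have hle (n : ℕ) : ‖Q n (u v)‖ ^ 2 ≤ ‖u v‖ ^ 2 / (n + 2 : ℕ) :=
      (norm_apply_sq_le_re_inner (hQ0 n) (hQ1 n) _).trans <|
        (hT n).re_inner_le (by omega) fun m hm b hb =>
          vectorFunctional_mul_of_minimal N hpN hp hmin hu hv (hAN hm) (hBN hb)
    have hlim : Tendsto (fun n : ℕ => ‖u v‖ ^ 2 / ((n + 2 : ℕ) : ℝ)) atTop (𝓝 0) :=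
      (tendsto_const_div_atTop_nhds_zero_nat _).comp (tendsto_add_atTop_nat 2)
    have hsq := squeeze_zero (fun n => sq_nonneg ‖Q n (u v)‖) hle hlim
    rw [tendsto_zero_iff_norm_tendsto_zero]
    have := hsq.sqrt
    simpa using this
  obtain ⟨n, hn⟩ := (hnormal.exists_re_lt hQ0 hQ1 (tendsto_apply_zero_of_dense_span hQnorm hprod
    (hfactor.span_topologicalClosure_eq_top hpN hp hp0)) one_half_pos).exists
  have := hlt n
  linarith
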